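/- Let $\mathbb F$ be a field. A \emph{stack branching program} (SBP) over a symbol set $S$ is a finite directed acyclic graph with two distinct vertices $s,t$ in which every edge $e$ carries a label $w(e)\in\mathbb F\cup\{X_1,X_2,\dots\}$ and a stack operation $\sigma(e)$, which is $\mathrm{push}(a)$ or $\mathrm{pop}(a)$ for some $a\in S$, or $\mathrm{nop}$. The \emph{realizable} sequences of stack operations form the smallest set that contains the empty sequence, is closed under concatenation, and contains $\mathrm{push}(a)\,P\,\mathrm{pop}(a)$ (for all $a\in S$), $\mathrm{nop}\,P$ and $P\,\mathrm{nop}$ whenever it contains $P$. The SBP computes the polynomial $\sum_P\prod_{e\in P}w(e)$, where $P$ runs over all directed paths from $s$ to $t$ whose sequence of stack operations is realizable. Its size is its number of vertices. It has \emph{width} $k$ if its vertices can be organised into layers $L_0,L_1,\dots$ of at most $k$ vertices each such that every edge goes from some $L_i$ to $L_{i+1}$. $\mathsf{VP}$ is the class of families $(f_n)_{n\in\mathbb N}$ of polynomials over $\mathbb F$ whose degree is bounded by a polynomial in $n$ and which are computed by arithmetic circuits (with $+$- and $\times$-gates of fanin $2$ and with inputs from $\mathbb F\cup\{X_1,X_2,\dots\}$)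 of size polynomial in $n$. \textbf{Lemma.} Every family $(f_n)\in\mathsf{VP}$ is computed by a family of SBPs of width $2$ and of size polynomial in $n$ over the stack symbol set $\{0,1\}$. Moreover, bounding the width does not reduce the power of SBPs: every family $(f_n)$ of polynomials that is computed by SBPs of size polynomial in $n$, of arbitrary width and over arbitrary symbol sets $S_n$, is computed by SBPs of width $2$ and of size polynomial in $n$ over the stack symbol set $\{0,1\}$. -/

import Mathlib

/-- A label: a constant of `F` or one of the variables `X 0, X 1, …`. -/
inductive Label (F : Type*) where
  | const (a : F) : Label F
  | var (i : ℕ) : Label F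

/-- The polynomial denoted by a label. -/
noncomputable def Label.toPoly {F : Type*} [Field F] : Label F → MvPolynomial ℕ F
  | .const a => MvPolynomial.C a
  | .var i => MvPolynomial.X i

/-! ### Arithmetic circuits and the class VP -/

/-- A gate over the gate set `V`: an input gate carrying a label, or a computation gate with its
two children (which may coincide). -/
inductive Gate (F : Type*) (V : Type*) where
  | input (a : Label F) : Gate F V
  | add (u w : V) : Gate F V
  | mul (u w : V) : Gate F V

/-- `g.HasChild u`: the gate `u` is a child of `g`. -/
def Gate.HasChild {F V : Type*} : Gate F V → V → Prop
  | .input _, _ => False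
  | .add u w, x => x = u ∨ x = w
  | .mul u w, x => x = u ∨ x = w

/-- An arithmetic circuit over `F`: a finite directed acyclic graph of gates of fanin `0` or `2`
with a unique sink, the output gate. -/
structure ArithCircuit (F : Type*) where
  /-- the set of gates -/
  V : Type
  [fintypeV : Fintype V]
  gate : V → Gate F V
  acyclic : ∀ v, ¬ Relation.TransGen (fun u v => (gate v).HasChild u) v v
  output : V
  sink_iff : ∀ v, (∀ u, ¬ (gate u).HasChild v) ↔ v = output

namespace ArithCircuit

attribute [instance] ArithCircuit.fintypeV

variable {F : Type*}

/-- The size of a circuit is its number of gates. -/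
def size (C : ArithCircuit F) : ℕ := Fintype.card C.V

theorem wellFounded (C : ArithCircuit F) :
    WellFounded (fun u v => (C.gate v).HasChild u) := by
  have h : WellFounded (Relation.TransGen (fun u v => (C.gate v).HasChild u)) := by
    have : Std.Irrefl (Relation.TransGen (fun u v => (C.gate v).HasChild u)) := ⟨C.acyclic⟩
    exact Finite.wellFounded_of_trans_of_irrefl _
  exact Subrelation.wf
    (r := Relation.TransGen (fun u v => (C.gate v).HasChild u))
    (fun {_ _} h' => Relation.TransGen.single h') h

/-- The polynomial computed at a gate. -/
noncomputable def valueAt [Field F] (C : ArithCircuit F) (v : C.V) : MvPolynomial ℕ F :=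
  match h : C.gate v with
  | .input a => a.toPoly
  | .add u w => C.valueAt u + C.valueAt w
  | .mul u w => C.valueAt u * C.valueAt w
termination_by C.wellFounded.wrap v
decreasing_by
  all_goals
    change (C.gate v).HasChild _
    rw [h]
    first | exact Or.inl rfl | exact Or.inr rfl

theorem valueAt_input [Field F] (C : ArithCircuit F) {v : C.V} {a : Label F}
    (h : C.gate v = .input a) : C.valueAt v = a.toPoly := by
  rw [valueAt]
  split <;> simp_all

theorem valueAt_add [Field F] (C : ArithCircuit F) {v u w : C.V}
    (h : C.gate v = .add u w) : C.valueAt v = C.valueAt u + C.valueAt w := by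
  rw [valueAt]
  split <;> simp_all

theorem valueAt_mul [Field F] (C : ArithCircuit F) {v u w : C.V}
    (h : C.gate v = .mul u w) : C.valueAt v = C.valueAt u * C.valueAt w := by
  rw [valueAt]
  split <;> simp_all

/-- The polynomial computed by a circuit: the one computed at its output gate. -/
noncomputable def poly [Field F] (C : ArithCircuit F) : MvPolynomial ℕ F := C.valueAt C.output

end ArithCircuit

/-- The class VP over `F`: families of polynomials of polynomially bounded degree that are computed
by a family of arithmetic circuits of polynomially bounded size. -/
def VP (F : Type*) [Field F] : Set (ℕ → MvPolynomial ℕ F) :=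
  {f | (∃ p : Polynomial ℕ, ∀ n, (f n).totalDegree ≤ p.eval n) ∧
    ∃ (p : Polynomial ℕ) (C : ℕ → ArithCircuit F),
      ∀ n, (C n).size ≤ p.eval n ∧ (C n).poly = f n}

/-! ### Arithmetic branching programs -/

/-- An arithmetic branching program: a finite directed acyclic graph with two vertices `s`, `t`
and an edge labelling `w` (only the values of `w` on edges matter). -/
structure ABP (F : Type*) where
  /-- the set of vertices -/
  V : Type
  [fintypeV : Fintype V]
  /-- `Adj u v`: there is an edge from `u` to `v` -/
  Adj : V → V → Prop
  acyclic : ∀ v, ¬ Relation.TransGen Adj v v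
  s : V
  t : V
  s_ne_t : s ≠ t
  w : V → V → Label F

namespace ABP

attribute [instance] ABP.fintypeV

variable {F : Type*}

/-- The size of a branching program is its number of vertices. -/
def size (G : ABP F) : ℕ := Fintype.card G.V

/-- `P` is the vertex sequence of a directed path from `u` to `v`. -/
def IsPath (G : ABP F) (u v : G.V) (P : List G.V) : Prop :=
  P.IsChain G.Adj ∧ P.head? = some u ∧ P.getLast? = some v

/-- The weight of a path: the product of the labels of its edges. -/
noncomputable def weight [Field F] (G : ABP F) : List G.V → MvPolynomial ℕ F
  | u :: v :: P => (G.w u v).toPoly * G.weight (v :: P)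
  | _ => 1

/-- The program is organised in layers, with edges only from each layer to the next one and at most
`k` vertices in each layer. -/
def HasWidth (G : ABP F) (k : ℕ) : Prop :=
  ∃ layer : G.V → ℕ, (∀ u v, G.Adj u v → layer v = layer u + 1) ∧
    ∀ i, {v | layer v = i}.ncard ≤ k

/-- In a finite acyclic graph there are only finitely many paths. -/
theorem finite_chains (G : ABP F) : {P : List G.V | P.IsChain G.Adj}.Finite := by
  refine (List.finite_length_le G.V (Fintype.card G.V)).subset fun P hP => ?_
  have h1 : P.IsChain (Relation.TransGen G.Adj) :=
    List.IsChain.imp (fun _ _ h => Relation.TransGen.single h) hP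
  have h2 : P.Nodup := by
    refine (List.isChain_iff_pairwise.mp h1).imp ?_
    rintro a b h rfl
    exact G.acyclic _ h
  exact h2.length_le_card

end ABP

/-! ### Stack branching programs -/

/-- The stack operations over the symbol set `S`. -/
inductive StackOp (S : Type*) where
  | push (a : S) : StackOp S
  | pop (a : S) : StackOp S
  | nop : StackOp S

/-- Realizable sequences of stack operations. -/
inductive Realizable {S : Type*} : List (StackOp S) → Prop
  | nil : Realizable []
  | push_pop (a : S) {P : List (StackOp S)} :
      Realizable P → Realizable (StackOp.push a :: (P ++ [StackOp.pop a]))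
  | nop_left {P : List (StackOp S)} : Realizable P → Realizable (StackOp.nop :: P)
  | nop_right {P : List (StackOp S)} : Realizable P → Realizable (P ++ [StackOp.nop])
  | append {P Q : List (StackOp S)} : Realizable P → Realizable Q → Realizable (P ++ Q)

/-- A stack branching program over the symbol set `S`: an arithmetic branching program whose edges
additionally carry stack operations (only the values of `σ` on edges matter). -/
structure SBP (F : Type*) (S : Type*) extends ABP F where
  σ : V → V → StackOp S

namespace SBP

variable {F S : Type*}

/-- The sequence of stack operations along a path. -/
def ops (G : SBP F S) : List G.V → List (StackOp S)
  | u :: v :: P => G.σ u v :: G.ops (v :: P)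
  | _ => []

/-- The stack-realizable paths from `s` to `t`. -/
def realizablePaths (G : SBP F S) : Set (List G.V) :=
  {P | G.IsPath G.s G.t P ∧ Realizable (G.ops P)}

theorem finite_realizablePaths (G : SBP F S) : G.realizablePaths.Finite :=
  G.finite_chains.subset fun _ hP => hP.1.1

/-- The polynomial computed by a stack branching program: the sum of the weights of its
stack-realizable `s`-`t`-paths. -/
noncomputable def poly [Field F] (G : SBP F S) : MvPolynomial ℕ F :=
  ∑ P ∈ G.finite_realizablePaths.toFinset, G.weight P

end SBP

/-- `f` is computed by a family of stack branching programs of polynomially bounded size, the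
`n`-th one over the symbol set `S n`. -/
def ComputedByPolySizeSBPs {F : Type*} [Field F] (S : ℕ → Type*)
    (f : ℕ → MvPolynomial ℕ F) : Prop :=
  ∃ (p : Polynomial ℕ) (G : ∀ n, SBP F (S n)), ∀ n, (G n).size ≤ p.eval n ∧ (G n).poly = f n

/-- `f` is computed by a family of stack branching programs of width `k` and polynomially bounded
size over the symbol set `S`. -/
def ComputedByPolySizeSBPsOfWidth {F : Type*} [Field F] (k : ℕ) (S : Type*)
    (f : ℕ → MvPolynomial ℕ F) : Prop :=
  ∃ (p : Polynomial ℕ) (G : ℕ → SBP F S),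
    ∀ n, (G n).size ≤ p.eval n ∧ (G n).HasWidth k ∧ (G n).poly = f n

/-!
A sequence of stack operations is realizable exactly if it leads from the empty stack to the empty
stack (`Realizable.iff_run_eq`). Hence the sum over the paths from a vertex to `t` that empty a
given stack obeys a recursion over the first edge (`SBP.pathSum_of_ne`), and a stack branching
program computes the value of this recursion at `s` and the empty stack.

Programs of width two are handled through their layers. Read backwards, a layer acts on the
functions that assign to each vertex and stack the value of the rest of the program, so that blocks
of layers can be composed. The useful blocks are the straight-line block and the *optional* block,
which branches from the main line into a side line, performs some instructions there and joins the
main line again.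

Both parts of the theorem go through weighted stack rewriting (`Rule.value`): a step removes the top
symbol of the stack and applies one of the rules for it. Such a step is performed in width two by
one optional block for each rule, on stacks encoded by binary words of a fixed length
(`Layer.actList_round`). An applied rule leaves a marker on top of the stack, which is removed at
the end of the round. So no two rules can be applied in the same round, and one must be; this makes
the accepted paths correspond bijectively to the rewritings, without any overcounting.

* For a stack branching program the current vertex is kept on top of the stack and every edge gives
  a rule (`SBP.value_rules`). As only finitely many symbols occur on the edges, they can first be
  renamed to pairs of vertices.
* For a circuit and a degree bound `D` the stack symbols are the homogeneous components of degree at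
  most `D` of the gates, and the rules expand a component according to the gate
  (`ArithCircuit.value_rules`). Components of degree `0` are constants, and they are rewritten at
  once. The expansions of the others split into at most `D` branches of positive degree, so that a
  polynomial number of steps suffices, although the circuit itself need not be a formula.

In both cases the number of rounds is fixed in advance; shorter rewritings are padded by a rule that
leaves the stack as it is.
-/

/-! ### Realizable sequences and runs of a stack -/

namespace StackOp

open Classical in
/-- The effect of a stack operation on a stack whose top is the head of the list. It is undefined
(`none`) for a `pop a` on a stack whose top is not `a`. -/
noncomputable def apply {S : Type*} : StackOp S → List S → Option (List S)
  | push a, st => some (a :: st)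
  | pop _, [] => none
  | pop a, b :: st => if a = b then some st else none
  | nop, st => some st

/-- Renaming of the stack symbols. -/
def map {S S' : Type*} (g : S → S') : StackOp S → StackOp S'
  | push a => push (g a)
  | pop a => pop (g a)
  | nop => nop

/-- The effect of a sequence of stack operations, `none` if one of them cannot be performed. -/
noncomputable def run {S : Type*} : List (StackOp S) → List S → Option (List S)
  | [], st => some st
  | o :: P, st => (o.apply st).bind (run P)

theorem run_append {S : Type*} (P Q : List (StackOp S)) (st : List S) :
    run (P ++ Q) st = (run P st).bind (run Q) := by
  induction P generalizing st with
  | nil => simp [run]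
  | cons o P ih =>
    simp only [List.cons_append, run]
    cases o.apply st <;> simp [ih]

end StackOp

namespace Realizable

open StackOp

variable {S : Type*}

theorem run_eq {P : List (StackOp S)} (h : Realizable P) (st : List S) : run P st = some st := by
  induction h generalizing st with
  | nil => rfl
  | push_pop a _ ih => simp [run, run_append, ih, StackOp.apply]
  | nop_left _ ih => simp [run, ih, StackOp.apply]
  | nop_right _ ih => simp [run, run_append, ih, StackOp.apply]
  | append _ _ ih₁ ih₂ => simp [run_append, ih₁, ih₂]

theorem map {S' : Type*} (g : S → S') {P : List (StackOp S)} (h : Realizable P) :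
    Realizable (P.map (StackOp.map g)) := by
  induction h with
  | nil => exact .nil
  | push_pop a _ ih => simpa [StackOp.map] using ih.push_pop (g a)
  | nop_left _ ih => simpa [StackOp.map] using ih.nop_left
  | nop_right _ ih => simpa [StackOp.map] using ih.nop_right
  | append _ _ ih₁ ih₂ => simpa using ih₁.append ih₂

/-- `Clears [a₁, …, aₖ] P`: the sequence `P` has the form `R₁ pop(a₁) R₂ ⋯ Rₖ pop(aₖ) R` with
realizable `R₁, …, Rₖ, R`. -/
def Clears : List S → List (StackOp S) → Prop
  | [], P => Realizable P
  | a :: st, P => ∃ R Q, P = R ++ pop a :: Q ∧ Realizable R ∧ Clears st Q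

theorem Clears.append {st : List S} {R P : List (StackOp S)} (hR : Realizable R)
    (hP : Clears st P) : Clears st (R ++ P) := by
  cases st with
  | nil => exact hR.append hP
  | cons a st =>
    obtain ⟨R', Q, rfl, hR', hQ⟩ := hP
    exact ⟨R ++ R', Q, by simp, hR.append hR', hQ⟩

theorem clears_of_run_eq {P : List (StackOp S)} {st : List S} (h : run P st = some []) :
    Clears st P := by
  induction P generalizing st with
  | nil =>
    obtain rfl : st = [] := by simpa [run] using h
    exact .nil
  | cons o P ih =>
    cases o with
    | nop => exact Clears.append (R := [nop]) (.nop_left .nil) (ih (by simpa [run, apply] using h))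
    | push a =>
      obtain ⟨R, Q, rfl, hR, hQ⟩ := ih (st := a :: st) (by simpa [run, apply] using h)
      simpa using Clears.append (hR.push_pop a) hQ
    | pop a =>
      cases st with
      | nil => simp [run, apply] at h
      | cons b st =>
        by_cases hab : a = b
        · subst hab
          exact ⟨[], P, rfl, .nil, ih (by simpa [run, apply] using h)⟩
        · simp [run, apply, hab] at h

/-- A sequence of stack operations is realizable if and only if it leads from the empty stack to
the empty stack. -/
theorem iff_run_eq {P : List (StackOp S)} : Realizable P ↔ run P [] = some [] :=
  ⟨fun h => h.run_eq [], clears_of_run_eq⟩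

end Realizable

/-! ### Path sums of stack branching programs -/

theorem ABP.IsPath.cons {F : Type*} {G : ABP F} {u x v : G.V} {P : List G.V} (h : G.Adj u x)
    (hP : G.IsPath x v P) : G.IsPath u v (u :: P) := by
  obtain ⟨h₁, h₂, h₃⟩ := hP
  cases P with
  | nil => simp at h₂
  | cons y P =>
    obtain rfl : y = x := by simpa using h₂
    exact ⟨List.isChain_cons_cons.2 ⟨h, h₁⟩, rfl, by simpa using h₃⟩

/-- A path that does not end where it starts has a first edge. -/
theorem ABP.IsPath.exists_cons {F : Type*} {G : ABP F} {u v : G.V} {P : List G.V}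
    (hP : G.IsPath u v P) (huv : u ≠ v) :
    ∃ x Q, P = u :: x :: Q ∧ G.Adj u x ∧ G.IsPath x v (x :: Q) := by
  obtain ⟨h₁, h₂, h₃⟩ := hP
  match P with
  | [] => simp at h₂
  | [y] => simp_all
  | y :: x :: Q =>
    obtain rfl : y = u := by simpa using h₂
    rw [List.isChain_cons_cons] at h₁
    exact ⟨x, Q, rfl, h₁.1, h₁.2, rfl, by simpa using h₃⟩

/-- Since the graph is acyclic, the one-vertex path is the only closed path. -/
theorem ABP.isPath_self_iff {F : Type*} {G : ABP F} {v : G.V} {P : List G.V} :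
    G.IsPath v v P ↔ P = [v] := by
  constructor
  · rintro ⟨h₁, h₂, h₃⟩
    match P with
    | [] => simp at h₂
    | [y] => simpa using h₂
    | y :: x :: Q =>
      obtain rfl : y = v := by simpa using h₂
      have h : ((y :: x :: Q).IsChain (Relation.TransGen G.Adj)) :=
        List.IsChain.imp (fun _ _ h => Relation.TransGen.single h) h₁
      rw [List.isChain_iff_pairwise, List.pairwise_cons] at h
      refine (G.acyclic y (h.1 y ?_)).elim
      rw [List.getLast?_cons_cons] at h₃
      exact List.mem_of_getLast? h₃
  · rintro rfl
    exact ⟨List.isChain_singleton v, rfl, rfl⟩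

namespace SBP

open StackOp

variable {F S : Type*}

/-- The paths from `u` to the target `t` that start with the stack `st` and end with the empty
stack. -/
def clearingPaths (G : SBP F S) (u : G.V) (st : List S) : Set (List G.V) :=
  {P | G.IsPath u G.t P ∧ run (G.ops P) st = some []}

theorem finite_clearingPaths (G : SBP F S) (u : G.V) (st : List S) :
    (G.clearingPaths u st).Finite :=
  G.finite_chains.subset fun _ hP => hP.1.1

/-- The sum of the weights of all paths from `u` to `t` that lead from the stack `st` to the empty
stack. -/
noncomputable def pathSum [Field F] (G : SBP F S) (u : G.V) (st : List S) : MvPolynomial ℕ F :=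
  ∑ P ∈ (G.finite_clearingPaths u st).toFinset, G.weight P

theorem poly_eq_pathSum [Field F] (G : SBP F S) : G.poly = G.pathSum G.s [] := by
  refine Finset.sum_congr ?_ fun _ _ => rfl
  ext P
  simp [realizablePaths, clearingPaths, Realizable.iff_run_eq]

theorem pathSum_t [Field F] (G : SBP F S) (st : List S) :
    G.pathSum G.t st = if st = [] then 1 else 0 := by
  split_ifs with h
  · have : (G.finite_clearingPaths G.t st).toFinset = {[G.t]} := by
      ext P
      simp only [Set.Finite.mem_toFinset, Finset.mem_singleton, clearingPaths, Set.mem_ofPred_eq,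
        ABP.isPath_self_iff, and_iff_left_iff_imp]
      rintro rfl
      simp [ops, run, h]
    rw [pathSum, this, Finset.sum_singleton, ABP.weight]
    rintro _ _ _ ⟨⟩
  · have : (G.finite_clearingPaths G.t st).toFinset = ∅ := by
      ext P
      simp only [Set.Finite.mem_toFinset, clearingPaths, Set.mem_ofPred_eq,
        ABP.isPath_self_iff, Finset.notMem_empty, iff_false, not_and]
      rintro rfl
      simp [ops, run, h]
    rw [pathSum, this, Finset.sum_empty]

open Classical in
/-- The path sum satisfies the recursion over the first edge of a path. -/
theorem pathSum_of_ne [Field F] (G : SBP F S) {u : G.V} (hu : u ≠ G.t) (st : List S) :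
    G.pathSum u st = ∑ x, if G.Adj u x then
      (G.w u x).toPoly * ((G.σ u x).apply st).elim 0 (G.pathSum x) else 0 := by
  let T : G.V → Finset (List G.V) := fun x => if G.Adj u x then
    ((G.σ u x).apply st).elim ∅ fun st' => (G.finite_clearingPaths x st').toFinset else ∅
  have memT : ∀ x P, P ∈ T x ↔ G.Adj u x ∧ G.IsPath x G.t P ∧
      ((G.σ u x).apply st).bind (run (G.ops P)) = some [] := by
    intro x P
    by_cases h : G.Adj u x <;> cases h' : (G.σ u x).apply st <;> simp [T, h, h', clearingPaths]
  have head : ∀ x P, P ∈ T x → ∃ Q, P = x :: Q := by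
    intro x P hP
    obtain ⟨-, ⟨-, h, -⟩, -⟩ := (memT x P).1 hP
    cases P with
    | nil => simp at h
    | cons y P => exact ⟨P, by simpa using h⟩
  have key : (G.finite_clearingPaths u st).toFinset =
      Finset.univ.biUnion fun x => (T x).image (u :: ·) := by
    ext P
    simp only [Set.Finite.mem_toFinset, Finset.mem_biUnion, Finset.mem_univ, true_and,
      Finset.mem_image, memT]
    constructor
    · rintro ⟨hP, hr⟩
      obtain ⟨x, Q, rfl, hux, hQ⟩ := hP.exists_cons hu
      exact ⟨x, x :: Q, ⟨hux, hQ, hr⟩, rfl⟩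
    · rintro ⟨x, Q, ⟨hux, hQ, hr⟩, rfl⟩
      obtain ⟨Q, rfl⟩ := head x Q ((memT x Q).2 ⟨hux, hQ, hr⟩)
      exact ⟨hQ.cons hux, hr⟩
  rw [pathSum, key, Finset.sum_biUnion]
  · refine Finset.sum_congr rfl fun x _ => ?_
    rw [Finset.sum_image fun _ _ _ _ h => (List.cons.inj h).2]
    have : ∀ P ∈ T x, G.weight (u :: P) = (G.w u x).toPoly * G.weight P := by
      intro P hP
      obtain ⟨Q, rfl⟩ := head x P hP
      rw [ABP.weight]
    rw [Finset.sum_congr rfl this, ← Finset.mul_sum]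
    by_cases h : G.Adj u x <;> cases h' : (G.σ u x).apply st <;> simp [T, h, h', pathSum]
  · intro x _ y _ hxy
    rw [Function.onFun, Finset.disjoint_left]
    intro P hx hy
    obtain ⟨P₁, h₁, rfl⟩ := Finset.mem_image.1 hx
    obtain ⟨P₂, h₂, h⟩ := Finset.mem_image.1 hy
    obtain ⟨Q₁, rfl⟩ := head _ _ h₁
    obtain ⟨Q₂, rfl⟩ := head _ _ h₂
    simp only [List.cons.injEq, true_and] at h
    exact hxy h.1.symm

end SBP

/-! ### Layered programs of width two -/

/-- A labelled stack instruction: what an edge of a stack branching program carries. -/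
abbrev Instr (F S : Type*) := Label F × StackOp S

/-- The edges between two consecutive layers of a program of width two, both layers being indexed
by `Bool`. The vertex `false` is on the main line of the program, `true` on its side line. -/
abbrev Layer (F S : Type*) := Bool → Bool → Option (Instr F S)

namespace Layer

variable {F S : Type*}

/-- If `k b st` is the value of the rest of a program, entered in the vertex `b` with the stack
`st`, then `M.act k` is the value of the program with the layer `M` put in front. -/
noncomputable def act [Field F] (M : Layer F S) (k : Bool → List S → MvPolynomial ℕ F) (b : Bool)
    (st : List S) : MvPolynomial ℕ F :=
  ∑ b', (M b b').elim 0 fun i => i.1.toPoly * (i.2.apply st).elim 0 (k b')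

/-- The value of a sequence of layers that is followed by a program of value `k`. -/
noncomputable def actList [Field F] (L : List (Layer F S))
    (k : Bool → List S → MvPolynomial ℕ F) : Bool → List S → MvPolynomial ℕ F :=
  L.foldr act k

theorem actList_append [Field F] (L L' : List (Layer F S))
    (k : Bool → List S → MvPolynomial ℕ F) : actList (L ++ L') k = actList L (actList L' k) :=
  List.foldr_append

theorem actList_cons [Field F] (M : Layer F S) (L : List (Layer F S))
    (k : Bool → List S → MvPolynomial ℕ F) : actList (M :: L) k = M.act (actList L k) :=
  rfl

open Classical in
/-- The value of the empty program: acceptance on the main line with the empty stack. -/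
noncomputable def accept [Field F] (b : Bool) (st : List S) : MvPolynomial ℕ F :=
  if b = false ∧ st = [] then 1 else 0

/-- What the edge from `u` to `v` carries in the graph of a layered program, `none` if there is no
such edge. -/
def edge (L : List (Layer F S)) (u v : Fin (L.length + 1) × Bool) : Option (Instr F S) :=
  if (v.1 : ℕ) = u.1 + 1 then L[(u.1 : ℕ)]?.bind fun M => M u.2 v.2 else none

theorem fst_eq_of_isSome_edge {L : List (Layer F S)} {u v : Fin (L.length + 1) × Bool}
    (h : (edge L u v).isSome) : (v.1 : ℕ) = u.1 + 1 := by
  by_contra h'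
  simp [edge, h'] at h

/-- The graph of a layered program. -/
def toSBP [Field F] (L : List (Layer F S)) (hL : L ≠ []) : SBP F S where
  V := Fin (L.length + 1) × Bool
  Adj u v := (edge L u v).isSome
  acyclic v h := by
    have : ∀ u v : Fin (L.length + 1) × Bool,
        Relation.TransGen (fun u v => ((edge L u v).isSome : Prop)) u v → u.1 < v.1 := by
      intro u v h
      induction h with
      | single h => exact Fin.lt_def.2 (by have := fst_eq_of_isSome_edge h; omega)
      | tail _ h ih =>
        have := fst_eq_of_isSome_edge h
        exact ih.trans (Fin.lt_def.2 (by omega))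
    exact lt_irrefl _ (this v v h)
  s := (0, false)
  t := (Fin.last _, false)
  s_ne_t h := by
    have := congrArg (fun x : Fin (L.length + 1) × Bool => (x.1 : ℕ)) h
    simp only [Fin.val_zero, Fin.val_last] at this
    exact hL (List.length_eq_zero_iff.1 this.symm)
  w u v := (edge L u v).elim (.const 0) Prod.fst
  σ u v := (edge L u v).elim .nop Prod.snd

theorem size_toSBP [Field F] (L : List (Layer F S)) (hL : L ≠ []) :
    (toSBP L hL).size = 2 * (L.length + 1) := by
  change Fintype.card (Fin (L.length + 1) × Bool) = _
  rw [Fintype.card_prod, Fintype.card_fin, Fintype.card_bool, mul_comm]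

theorem hasWidth_toSBP [Field F] (L : List (Layer F S)) (hL : L ≠ []) : (toSBP L hL).HasWidth 2 := by
  refine ⟨fun v => v.1.val, fun u v h => fst_eq_of_isSome_edge h, fun i => ?_⟩
  have : Set.InjOn (fun v : Fin (L.length + 1) × Bool => v.2) {v | v.1.val = i} := by
    rintro ⟨x, b⟩ hx ⟨y, c⟩ hy (rfl : b = c)
    exact Prod.ext (Fin.ext (hx.trans hy.symm)) rfl
  refine (Set.ncard_le_ncard_of_injOn (t := Set.univ) _ (fun _ _ => Set.mem_univ _) this).trans ?_
  simp

theorem pathSum_toSBP [Field F] (L : List (Layer F S)) (hL : L ≠ [])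
    (u : Fin (L.length + 1) × Bool) (st : List S) :
    (toSBP L hL).pathSum u st = actList (L.drop u.1) accept u.2 st := by
  classical
  obtain ⟨⟨i, hi⟩, b⟩ := u
  induction hn : L.length - i generalizing i b st with
  | zero =>
    obtain rfl : i = L.length := by omega
    cases b with
    | false =>
      refine ((toSBP L hL).pathSum_t st).trans ?_
      simp [actList, accept]
    | true =>
      refine (SBP.pathSum_of_ne (toSBP L hL) (u := (⟨L.length, hi⟩, true))
        (fun h => Bool.noConfusion (congrArg Prod.snd h)) st).trans ?_
      simp only [List.drop_length, actList, accept, List.foldr_nil, Bool.true_eq_false, false_and,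
        if_false]
      refine Finset.sum_eq_zero fun x _ => if_neg ?_
      simp [toSBP, edge]
  | succ n ih =>
    have hi' : i < L.length := by omega
    have hne : ((⟨i, hi⟩, b) : Fin (L.length + 1) × Bool) ≠ (toSBP L hL).t := by
      intro h
      have := congrArg (fun x : Fin (L.length + 1) × Bool => (x.1 : ℕ)) h
      simp only [toSBP, Fin.val_last] at this
      omega
    refine (SBP.pathSum_of_ne (toSBP L hL) hne st).trans ?_
    rw [List.drop_eq_getElem_cons hi', actList_cons, act]
    have h₁ : ∀ x : Fin (L.length + 1) × Bool,
        (if (toSBP L hL).Adj (⟨i, hi⟩, b) x then ((toSBP L hL).w (⟨i, hi⟩, b) x).toPoly *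
          (((toSBP L hL).σ (⟨i, hi⟩, b) x).apply st).elim 0 ((toSBP L hL).pathSum x) else 0) =
        (edge L (⟨i, hi⟩, b) x).elim 0 fun j =>
          j.1.toPoly * (j.2.apply st).elim 0 ((toSBP L hL).pathSum x) := by
      intro x
      cases h : edge L (⟨i, hi⟩, b) x <;> simp [toSBP, h]
    refine (Finset.sum_congr rfl fun x _ => h₁ x).trans ((Fintype.sum_prod_type _).trans ?_)
    rw [Finset.sum_eq_single (⟨i + 1, by omega⟩ : Fin (L.length + 1))]
    · refine Finset.sum_congr rfl fun b' _ => ?_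
      have h₂ : edge L (⟨i, hi⟩, b) (⟨i + 1, by omega⟩, b') = L[i] b b' := by
        simp [edge, hi']
      rw [h₂]
      congr 1
      funext j
      congr 2
      funext st'
      exact ih st' b' (i + 1) (by omega) (by omega)
    · intro j _ hj
      refine Finset.sum_eq_zero fun b' _ => ?_
      have : ¬ (j : ℕ) = i + 1 := fun h => hj (Fin.ext h)
      simp [edge, this]
    · simp

/-- A layered program is a stack branching program of width two that computes its value. -/
theorem poly_toSBP [Field F] (L : List (Layer F S)) (hL : L ≠ []) :
    (toSBP L hL).poly = actList L accept false [] := by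
  rw [SBP.poly_eq_pathSum]
  exact pathSum_toSBP L hL (0, false) []

/-! ### Straight-line and optional blocks -/

/-- The value of a sequence of instructions that is followed by a program of value `k`. -/
noncomputable def exec [Field F] (l : List (Instr F S)) (k : List S → MvPolynomial ℕ F) :
    List S → MvPolynomial ℕ F :=
  l.foldr (fun i k st => i.1.toPoly * (i.2.apply st).elim 0 k) k

theorem exec_cons [Field F] (i : Instr F S) (l : List (Instr F S)) (k : List S → MvPolynomial ℕ F)
    (st : List S) : exec (i :: l) k st = i.1.toPoly * (i.2.apply st).elim 0 (exec l k) :=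
  rfl

/-- The instruction that does nothing. -/
def skip [Field F] : Instr F S := (.const 1, .nop)

theorem toPoly_skip [Field F] : (skip : Instr F S).1.toPoly = 1 := by
  simp [skip, Label.toPoly]

theorem apply_skip [Field F] (st : List S) : (skip : Instr F S).2.apply st = some st := by
  simp [skip, StackOp.apply]

/-- The block that performs the instructions `l` on the main line. -/
def straight (l : List (Instr F S)) : List (Layer F S) :=
  l.map fun i b b' => if b = false ∧ b' = false then some i else none

/-- The layer in which the main line passes and the side line performs the instruction `i`. -/
def side [Field F] (i : Instr F S) : Layer F S
  | false, false => some skip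
  | true, true => some i
  | _, _ => none

/-- The layer in which the main line branches into the main line and the side line. -/
def branch [Field F] : Layer F S
  | false, _ => some skip
  | true, _ => none

/-- The layer in which the side line joins the main line. -/
def join [Field F] : Layer F S
  | _, false => some skip
  | _, true => none

/-- The block that may or may not perform the instructions `l`: it branches into the main line,
where nothing happens, and the side line, where `l` is performed, and joins the two again. -/
def optional [Field F] (l : List (Instr F S)) : List (Layer F S) :=
  branch :: (l.map side ++ [join])

theorem length_straight (l : List (Instr F S)) : (straight l).length = l.length := by
  simp [straight]

theorem length_optional [Field F] (l : List (Instr F S)) :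
    (optional l).length = l.length + 2 := by
  simp [optional]

theorem actList_straight [Field F] (l : List (Instr F S)) (k : Bool → List S → MvPolynomial ℕ F)
    (st : List S) : actList (straight l) k false st = exec l (k false) st := by
  induction l generalizing st with
  | nil => rfl
  | cons i l ih =>
    rw [straight, List.map_cons, ← straight, actList_cons, act, exec_cons]
    simp [funext ih]

theorem actList_map_side [Field F] (l : List (Instr F S))
    (k : Bool → List S → MvPolynomial ℕ F) :
    actList (l.map side) k false = k false ∧ actList (l.map side) k true = exec l (k true) := by
  induction l with
  | nil => exact ⟨rfl, rfl⟩
  | cons i l ih =>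
    constructor <;> funext st <;> rw [List.map_cons, actList_cons, act]
    · simp [ih, side, toPoly_skip, apply_skip]
    · simp [ih, side, exec_cons]

theorem act_join [Field F] (k : Bool → List S → MvPolynomial ℕ F) (b : Bool) :
    join.act k b = k false := by
  funext st
  cases b <;> simp [act, join, toPoly_skip, apply_skip]

theorem actList_optional [Field F] (l : List (Instr F S)) (k : Bool → List S → MvPolynomial ℕ F)
    (st : List S) :
    actList (optional l) k false st = k false st + exec l (k false) st := by
  rw [optional, actList_cons, act, actList_append, Fintype.sum_bool]
  simp only [branch, Option.elim_some, toPoly_skip, apply_skip, one_mul]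
  rw [(actList_map_side _ _).1, (actList_map_side _ _).2, actList_cons, act_join, act_join, add_comm]
  rfl

end Layer

/-! ### Weighted rewriting of stacks -/

/-- A rewriting rule for a stack whose top symbol has just been removed: it has a weight and
performs a sequence of stack operations. -/
structure Rule (F Γ : Type*) where
  /-- the weight of the rule -/
  label : Label F
  /-- the operations the rule performs below the removed top symbol -/
  ops : List (StackOp Γ)

namespace Rule

open StackOp

variable {F Γ : Type*}

/-- One rewriting step, as an action on the values of stacks: if `k` gives the values after the
step, `step rules k` gives those before it. The rules `rules A` apply to the top symbol `A`. There
is no step from the empty stack. -/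
noncomputable def step [Field F] (rules : Γ → List (Rule F Γ)) (k : List Γ → MvPolynomial ℕ F) :
    List Γ → MvPolynomial ℕ F
  | [] => 0
  | A :: st => ((rules A).map fun r => r.label.toPoly * (run r.ops st).elim 0 k).sum

open Classical in
/-- The total weight of the rewritings of a stack into the stack `fin` in exactly `T` steps. -/
noncomputable def value [Field F] (rules : Γ → List (Rule F Γ)) (fin : List Γ) :
    ℕ → List Γ → MvPolynomial ℕ F
  | 0, st => if st = fin then 1 else 0
  | T + 1, st => step rules (value rules fin T) st

/-- All rules, each one with the top symbol it applies to. -/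
noncomputable def all [Fintype Γ] (rules : Γ → List (Rule F Γ)) : List (Γ × Rule F Γ) :=
  Finset.univ.toList.flatMap fun A => (rules A).map (Prod.mk A)

theorem length_all_le [Fintype Γ] {rules : Γ → List (Rule F Γ)} {M : ℕ}
    (h : ∀ A, (rules A).length ≤ M) : (all rules).length ≤ Fintype.card Γ * M := by
  rw [all, List.length_flatMap]
  refine (List.sum_le_card_nsmul _ M ?_).trans ?_
  · simpa using h
  · simp

/-- The step, written as a sum over all rules. -/
theorem sum_map_all [Field F] [Fintype Γ] (rules : Γ → List (Rule F Γ))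
    (k : List Γ → MvPolynomial ℕ F) (st : List Γ) :
    ((all rules).map fun p =>
      p.2.label.toPoly * (run (pop p.1 :: p.2.ops) st).elim 0 k).sum = step rules k st := by
  classical
  have h : ∀ l : List Γ, ((l.flatMap fun A => (rules A).map (Prod.mk A)).map fun p =>
      p.2.label.toPoly * (run (pop p.1 :: p.2.ops) st).elim 0 k).sum =
      (l.map fun A => ((rules A).map fun r =>
        r.label.toPoly * (run (pop A :: r.ops) st).elim 0 k).sum).sum := by
    intro l
    induction l with
    | nil => rfl
    | cons A l ih => simp [ih, Function.comp_def]
  rw [all, h, Finset.sum_map_toList]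
  cases st with
  | nil => simp [run, apply, step]
  | cons B st =>
    rw [Finset.sum_eq_single B]
    · simp [run, apply, step]
    · intro A _ hA
      simp [run, apply, hA]
    · simp

end Rule

/-! ### Binary encoding of stacks -/

namespace StackOp

variable {S : Type*}

theorem run_map_pop_eq_some {u st st' : List S} :
    run (u.map pop) st = some st' ↔ st = u ++ st' := by
  induction u generalizing st with
  | nil => simp [run]
  | cons a u ih =>
    cases st with
    | nil => simp [run, apply]
    | cons b st =>
      by_cases h : a = b
      · subst h
        simp [run, apply, ih]
      · simp [run, apply, h, Ne.symm h]

theorem run_map_push (u st : List S) : run (u.map push).reverse st = some (u ++ st) := by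
  induction u generalizing st with
  | nil => rfl
  | cons a u ih => simp [run_append, ih, run, apply]

/-- The translation of a stack operation under an encoding of the symbols by words. The first
letter of a word is the one that lies topmost on the stack. -/
def encode {Γ : Type*} (c : Γ → List S) : StackOp Γ → List (StackOp S)
  | push a => ((c a).map push).reverse
  | pop a => (c a).map pop
  | nop => [nop]

/-- The encoding `c` is injective with code words of the fixed positive length `K`. -/
structure IsBlockCode {Γ : Type*} (c : Γ → List S) (K : ℕ) : Prop where
  injective : Function.Injective c
  length_eq : ∀ a, (c a).length = K
  pos : 0 < K

variable {Γ : Type*} {c : Γ → List S} {K : ℕ}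

theorem IsBlockCode.length_encode_le (hc : IsBlockCode c K) (o : StackOp Γ) :
    (encode c o).length ≤ K := by
  cases o <;> simp [encode, hc.length_eq, Nat.succ_le_of_lt hc.pos]

theorem IsBlockCode.length_flatMap_encode_le (hc : IsBlockCode c K) (P : List (StackOp Γ)) :
    (P.flatMap (encode c)).length ≤ P.length * K := by
  rw [List.length_flatMap]
  refine (List.sum_le_card_nsmul _ K ?_).trans ?_
  · simpa using fun o _ => hc.length_encode_le o
  · simp

theorem IsBlockCode.run_map_pop_cons (hc : IsBlockCode c K) {a b : Γ} (hab : a ≠ b)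
    (st : List S) : run ((c a).map pop) (c b ++ st) = none := by
  rw [Option.eq_none_iff_forall_ne_some]
  intro st' h
  rw [run_map_pop_eq_some] at h
  have := (List.append_inj h (by rw [hc.length_eq, hc.length_eq])).1
  exact hab (hc.injective this).symm

theorem IsBlockCode.run_map_pop_nil (hc : IsBlockCode c K) (a : Γ) :
    run ((c a).map pop) [] = none := by
  rw [Option.eq_none_iff_forall_ne_some]
  intro st' h
  rw [run_map_pop_eq_some] at h
  have h₁ := congrArg List.length h
  have h₂ := hc.pos
  simp [hc.length_eq] at h₁
  omega

theorem IsBlockCode.run_encode (hc : IsBlockCode c K) (o : StackOp Γ) (st : List Γ) :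
    run (encode c o) (st.flatMap c) = (o.apply st).map (List.flatMap c) := by
  cases o with
  | push a => simp [encode, run_map_push, apply]
  | nop => simp [encode, run, apply]
  | pop a =>
    cases st with
    | nil => simpa [encode, apply] using hc.run_map_pop_nil a
    | cons b st =>
      by_cases h : a = b
      · subst h
        simp [encode, apply, run_map_pop_eq_some]
      · simpa [encode, apply, h] using hc.run_map_pop_cons h _

/-- Runs on encoded stacks are the encodings of the runs. -/
theorem IsBlockCode.run_flatMap_encode (hc : IsBlockCode c K) (P : List (StackOp Γ))
    (st : List Γ) :
    run (P.flatMap (encode c)) (st.flatMap c) = (run P st).map (List.flatMap c) := by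
  induction P generalizing st with
  | nil => rfl
  | cons o P ih =>
    rw [List.flatMap_cons, run_append, hc.run_encode, run]
    cases o.apply st <;> simp [ih]

theorem IsBlockCode.flatMap_eq_nil (hc : IsBlockCode c K) {st : List Γ} :
    st.flatMap c = [] ↔ st = [] := by
  cases st with
  | nil => simp
  | cons a st =>
    have h₁ := hc.pos
    have h₂ := hc.length_eq a
    simp only [List.flatMap_cons, List.append_eq_nil_iff, reduceCtorEq, iff_false, not_and]
    intro h
    simp [h] at h₂
    omega

/-- The code that sends a symbol to its indicator function. -/
theorem exists_isBlockCode (Γ : Type*) [Fintype Γ] [Nonempty Γ] :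
    ∃ c : Γ → List (Fin 2), IsBlockCode c (Fintype.card Γ) := by
  classical
  refine ⟨fun a => Finset.univ.toList.map fun b => if b = a then 1 else 0, ?_, ?_, ?_⟩
  · intro a b h
    simp only [List.map_inj_left, Finset.mem_toList, Finset.mem_univ, true_implies] at h
    simpa using h a
  · simp
  · exact Fintype.card_pos

end StackOp

/-! ### Rewriting by programs of width two -/

namespace Layer

open StackOp Rule

variable {F S Γ : Type*} [Field F]

/-- The instructions with label `1` and the given stack operations. -/
def free (P : List (StackOp S)) : List (Instr F S) :=
  P.map (Prod.mk (.const 1))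

theorem exec_free (P : List (StackOp S)) (k : List S → MvPolynomial ℕ F) (st : List S) :
    exec (free P) k st = (run P st).elim 0 k := by
  induction P generalizing st with
  | nil => rfl
  | cons o P ih =>
    rw [free, List.map_cons, exec_cons, ← free, run, funext ih]
    cases o.apply st <;> simp [Label.toPoly]

/-- The instructions that apply the rule `r` to the top symbol `A`. The code word of the marker
`none` is put on top in the end. -/
def ruleInstrs (c : Option Γ → List S) (A : Γ) (r : Rule F Γ) : List (Instr F S) :=
  (r.label, .nop) ::
    free ((pop A :: r.ops).flatMap (encode (c ∘ some)) ++ encode c (push none))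

/-- One step of the rewriting: every rule may be applied, then the marker is removed. The marker
prevents a second rule from being applied, and its removal forces that one was applied. -/
noncomputable def round [Fintype Γ] (c : Option Γ → List S) (rules : Γ → List (Rule F Γ)) :
    List (Layer F S) :=
  (all rules).flatMap (fun p => optional (ruleInstrs c p.1 p.2)) ++
    straight (free (encode c (pop none)))

variable {c : Option Γ → List S} {K : ℕ}

theorem _root_.StackOp.IsBlockCode.comp_some (hc : IsBlockCode c K) :
    IsBlockCode (c ∘ some) K :=
  ⟨hc.injective.comp (Option.some_injective _), fun _ => hc.length_eq _, hc.pos⟩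

theorem exec_ruleInstrs_marker (hc : IsBlockCode c K) (A : Γ) (r : Rule F Γ)
    (k : List S → MvPolynomial ℕ F) (st : List S) :
    exec (ruleInstrs c A r) k (c none ++ st) = 0 := by
  rw [ruleInstrs, exec_cons]
  simp only [StackOp.apply, Option.elim_some]
  rw [exec_free, List.flatMap_cons, run_append, run_append]
  simp only [encode, Function.comp_apply]
  rw [hc.run_map_pop_cons (by simp)]
  simp

theorem exec_ruleInstrs (hc : IsBlockCode c K) (A : Γ) (r : Rule F Γ)
    (k : List S → MvPolynomial ℕ F) (st : List Γ) :
    exec (ruleInstrs c A r) k (st.flatMap (c ∘ some)) =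
      r.label.toPoly * (run (pop A :: r.ops) st).elim 0
        fun st' => k (c none ++ st'.flatMap (c ∘ some)) := by
  rw [ruleInstrs, exec_cons]
  simp only [StackOp.apply, Option.elim_some]
  rw [exec_free, run_append, hc.comp_some.run_flatMap_encode]
  cases run (pop A :: r.ops) st <;> simp [encode, run_map_push]

theorem actList_rules_marker (hc : IsBlockCode c K) (l : List (Γ × Rule F Γ))
    (k : Bool → List S → MvPolynomial ℕ F) (st : List S) :
    actList (l.flatMap fun p => optional (ruleInstrs c p.1 p.2)) k false (c none ++ st) =
      k false (c none ++ st) := by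
  induction l with
  | nil => rfl
  | cons p l ih =>
    rw [List.flatMap_cons, actList_append, actList_optional, ih, exec_ruleInstrs_marker hc,
      add_zero]

theorem actList_rules (hc : IsBlockCode c K) (l : List (Γ × Rule F Γ))
    (k : Bool → List S → MvPolynomial ℕ F) (st : List Γ) :
    actList (l.flatMap fun p => optional (ruleInstrs c p.1 p.2)) k false
        (st.flatMap (c ∘ some)) =
      k false (st.flatMap (c ∘ some)) + (l.map fun p =>
        p.2.label.toPoly * (run (pop p.1 :: p.2.ops) st).elim 0
          fun st' => k false (c none ++ st'.flatMap (c ∘ some))).sum := by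
  induction l with
  | nil => simp [actList]
  | cons p l ih =>
    rw [List.flatMap_cons, actList_append, actList_optional, ih, exec_ruleInstrs hc,
      List.map_cons, List.sum_cons]
    simp only [actList_rules_marker hc]
    ring

/-- A round performs one rewriting step on encoded stacks. -/
theorem actList_round [Fintype Γ] (hc : IsBlockCode c K) (rules : Γ → List (Rule F Γ))
    (k : Bool → List S → MvPolynomial ℕ F) (st : List Γ) :
    actList (round c rules) k false (st.flatMap (c ∘ some)) =
      step rules (fun st' => k false (st'.flatMap (c ∘ some))) st := by
  rw [round, actList_append, actList_rules hc, ← sum_map_all]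
  have h₁ : actList (straight (free (encode c (pop none)))) k false (st.flatMap (c ∘ some)) = 0 := by
    rw [actList_straight, exec_free, encode]
    cases st with
    | nil =>
      rw [List.flatMap_nil, hc.run_map_pop_nil]
      rfl
    | cons a st =>
      rw [List.flatMap_cons, Function.comp_apply, hc.run_map_pop_cons (by simp)]
      rfl
  have h₂ : ∀ st', actList (straight (free (encode c (pop none)))) k false (c none ++ st') =
      k false st' := by
    intro st'
    rw [actList_straight, exec_free, encode, run_map_pop_eq_some.2 rfl]
    rfl
  simp only [h₁, h₂, zero_add]

theorem length_round_le [Fintype Γ] (hc : IsBlockCode c K) {rules : Γ → List (Rule F Γ)} {M : ℕ}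
    (hM : ∀ A, (rules A).length ≤ M) (hops : ∀ A, ∀ r ∈ rules A, r.ops.length ≤ 2) :
    (round c rules).length ≤ Fintype.card Γ * M * (4 * K + 3) + K := by
  have h : ∀ x ∈ (all rules).map (fun p => (optional (ruleInstrs c p.1 p.2)).length),
      x ≤ 4 * K + 3 := by
    intro x hx
    obtain ⟨⟨A, r⟩, hp, rfl⟩ := List.mem_map.1 hx
    simp only [all, List.mem_flatMap, List.mem_map, Prod.mk.injEq] at hp
    obtain ⟨B, _, r', hr, rfl, rfl⟩ := hp
    have h₁ := hc.comp_some.length_flatMap_encode_le (pop B :: r'.ops)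
    have h₂ := hc.length_encode_le (push none)
    have h₃ : (pop B :: r'.ops).length * K ≤ 3 * K :=
      Nat.mul_le_mul_right _ (Nat.succ_le_succ (hops B r' hr))
    simp only [length_optional, ruleInstrs, free, List.length_cons, List.length_map,
      List.length_append]
    omega
  have h₁ := List.sum_le_card_nsmul _ _ h
  have h₂ := hc.length_encode_le (pop none)
  have h₃ := Nat.mul_le_mul_right (4 * K + 3) (length_all_le hM)
  simp only [round, List.length_append, length_straight, free, List.length_map,
    List.length_flatMap, smul_eq_mul] at h₁ ⊢
  omega

/-- The program that writes the stack `ini`, performs `T` rewriting steps and removes the stack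
`fin`. The instruction in front makes the two ends of the program differ. -/
noncomputable def rewriting [Fintype Γ] (c : Option Γ → List S) (rules : Γ → List (Rule F Γ))
    (ini fin : List Γ) (T : ℕ) : List (Layer F S) :=
  straight (skip :: free ((ini.map push).reverse.flatMap (encode (c ∘ some)))) ++
    ((List.replicate T (round c rules)).flatten ++
      straight (free ((fin.map pop).flatMap (encode (c ∘ some)))))

theorem actList_rewriting [Fintype Γ] (hc : IsBlockCode c K) (rules : Γ → List (Rule F Γ))
    (ini fin : List Γ) (T : ℕ) :
    actList (rewriting c rules ini fin T) accept false [] = value rules fin T ini := by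
  have h : ∀ T, ∀ st : List Γ, actList ((List.replicate T (round c rules)).flatten ++
      straight (free ((fin.map pop).flatMap (encode (c ∘ some))))) accept false
        (st.flatMap (c ∘ some)) = value rules fin T st := by
    intro T
    induction T with
    | zero =>
      intro st
      rw [List.replicate_zero, List.flatten_nil, List.nil_append, actList_straight, exec_free,
        hc.comp_some.run_flatMap_encode, value]
      cases h : run (fin.map pop) st with
      | none =>
        rw [if_neg]
        · rfl
        · rintro rfl
          rw [run_map_pop_eq_some.2 (List.append_nil _).symm] at h
          simp at h
      | some st' =>
        rw [run_map_pop_eq_some] at h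
        subst h
        simp only [Option.map_some, Option.elim_some, accept, true_and,
          hc.comp_some.flatMap_eq_nil, List.append_right_eq_self]
    | succ T ih =>
      intro st
      rw [List.replicate_succ, List.flatten_cons, List.append_assoc, actList_append,
        actList_round hc, value]
      congr 1
      exact funext ih
  rw [rewriting, actList_append, actList_straight, exec_cons, toPoly_skip, one_mul, apply_skip,
    Option.elim_some, exec_free]
  have h₁ := hc.comp_some.run_flatMap_encode (ini.map push).reverse []
  rw [run_map_push, List.flatMap_nil, List.append_nil] at h₁
  rw [h₁]
  exact h T ini

theorem length_rewriting_le [Fintype Γ] (hc : IsBlockCode c K) {rules : Γ → List (Rule F Γ)}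
    {M : ℕ} (hM : ∀ A, (rules A).length ≤ M) (hops : ∀ A, ∀ r ∈ rules A, r.ops.length ≤ 2)
    {ini fin : List Γ} (hi : ini.length ≤ 2) (hf : fin.length ≤ 2) (T : ℕ) :
    (rewriting c rules ini fin T).length ≤
      1 + 4 * K + T * (Fintype.card Γ * M * (4 * K + 3) + K) := by
  have h₁ := hc.comp_some.length_flatMap_encode_le (ini.map push).reverse
  have h₂ := hc.comp_some.length_flatMap_encode_le (fin.map pop)
  have h₃ := Nat.mul_le_mul_left T (length_round_le hc hM hops)
  have h₄ := Nat.mul_le_mul_right K hi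
  have h₅ := Nat.mul_le_mul_right K hf
  simp only [List.length_map, List.length_reverse] at h₁ h₂
  simp only [rewriting, List.length_append, length_straight, free, List.length_map,
    List.length_cons, List.length_flatten, List.map_replicate, List.sum_replicate, smul_eq_mul]
  omega

end Layer

/-- The bound on the size of the program that performs `T` rewriting steps on stacks over `g`
symbols with at most `M` rules for each symbol. -/
def rewritingSize (g M T : ℕ) : ℕ :=
  2 * (2 + 4 * (g + 1) + T * (g * M * (4 * (g + 1) + 3) + (g + 1)))

theorem rewritingSize_mono {g g' M M' T T' : ℕ} (hg : g ≤ g') (hM : M ≤ M') (hT : T ≤ T') :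
    rewritingSize g M T ≤ rewritingSize g' M' T' := by
  unfold rewritingSize
  gcongr

/-- Weighted stack rewriting is performed by stack branching programs of width two over two
symbols. -/
theorem exists_sbp_poly_eq_value {F Γ : Type*} [Field F] [Fintype Γ] (rules : Γ → List (Rule F Γ))
    {M : ℕ} (hM : ∀ A, (rules A).length ≤ M) (hops : ∀ A, ∀ r ∈ rules A, r.ops.length ≤ 2)
    {ini fin : List Γ} (hi : ini.length ≤ 2) (hf : fin.length ≤ 2) (T : ℕ) :
    ∃ G : SBP F (Fin 2), G.size ≤ rewritingSize (Fintype.card Γ) M T ∧ G.HasWidth 2 ∧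
      G.poly = Rule.value rules fin T ini := by
  obtain ⟨c, hc⟩ := StackOp.exists_isBlockCode (Option Γ)
  rw [Fintype.card_option] at hc
  have hL : Layer.rewriting c rules ini fin T ≠ [] := by simp [Layer.rewriting, Layer.straight]
  refine ⟨Layer.toSBP _ hL, ?_, Layer.hasWidth_toSBP _ hL, ?_⟩
  · have := Layer.length_rewriting_le hc hM hops hi hf T
    rw [Layer.size_toSBP, rewritingSize]
    omega
  · rw [Layer.poly_toSBP, Layer.actList_rewriting hc]

/-! ### Simulation of stack branching programs -/

namespace SBP

open StackOp

variable {F S : Type*}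

open Classical in
/-- The rewriting rules that simulate a stack branching program: the current vertex lies on top of
the stack, every edge gives a rule, and the target may wait. -/
noncomputable def rules [Field F] (G : SBP F S) : G.V ⊕ S → List (Rule F (G.V ⊕ S))
  | .inl u =>
    if u = G.t then [⟨.const 1, [push (.inl u)]⟩]
    else Finset.univ.toList.flatMap fun x =>
      if G.Adj u x then [⟨G.w u x, [(G.σ u x).map .inr, push (.inl x)]⟩] else []
  | .inr _ => []

theorem length_rules_le [Field F] (G : SBP F S) (A : G.V ⊕ S) :
    (G.rules A).length ≤ G.size + 1 := by
  cases A with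
  | inr a => simp [rules]
  | inl u =>
    rw [rules]
    split_ifs
    · simp
    · rw [List.length_flatMap]
      refine (List.sum_le_card_nsmul _ 1 ?_).trans ?_
      · intro n hn
        obtain ⟨x, -, rfl⟩ := List.mem_map.1 hn
        split_ifs <;> simp
      · simp [ABP.size]

theorem length_ops_le_of_mem_rules [Field F] (G : SBP F S) (A : G.V ⊕ S) :
    ∀ r ∈ G.rules A, r.ops.length ≤ 2 := by
  intro r hr
  cases A with
  | inr a => simp [rules] at hr
  | inl u =>
    rw [rules] at hr
    split_ifs at hr
    · obtain rfl := List.mem_singleton.1 hr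
      simp
    · obtain ⟨x, -, hx⟩ := List.mem_flatMap.1 hr
      split_ifs at hx
      · obtain rfl := List.mem_singleton.1 hx
        simp
      · simp at hx

theorem _root_.StackOp.apply_map {S' : Type*} {g : S → S'} (hg : Function.Injective g)
    (o : StackOp S) (st : List S) : (o.map g).apply (st.map g) = (o.apply st).map (List.map g) := by
  cases o with
  | push a => rfl
  | nop => rfl
  | pop a =>
    cases st with
    | nil => rfl
    | cons b st => by_cases h : a = b <;> simp [StackOp.map, apply, h, hg.eq_iff]

/-- The number of vertices that can be reached from `u` by a nonempty path. -/
noncomputable def height (G : SBP F S) (u : G.V) : ℕ :=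
  {x | Relation.TransGen G.Adj u x}.ncard

theorem height_lt_of_adj (G : SBP F S) {u x : G.V} (h : G.Adj u x) : G.height x < G.height u := by
  refine Set.ncard_lt_ncard ⟨fun y hy => .head h hy, fun h' => ?_⟩ (Set.toFinite _)
  exact G.acyclic x (h' (Relation.TransGen.single h))

theorem height_le_size (G : SBP F S) (u : G.V) : G.height u ≤ G.size := by
  refine (Set.ncard_le_ncard (Set.subset_univ _)).trans_eq ?_
  rw [Set.ncard_univ, Nat.card_eq_fintype_card, ABP.size]

theorem value_rules_t [Field F] (G : SBP F S) (T : ℕ) (st : List S) :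
    Rule.value G.rules [.inl G.t] T (.inl G.t :: st.map .inr) = G.pathSum G.t st := by
  rw [pathSum_t]
  induction T with
  | zero => simp [Rule.value]
  | succ T ih => simp [Rule.value, Rule.step, rules, run, apply, ih, Label.toPoly]

/-- If the number of steps suffices for all paths from `u`, the simulation is correct from `u` on,
because the target may wait for the remaining steps. -/
theorem value_rules [Field F] (G : SBP F S) (T : ℕ) (u : G.V) (hu : G.height u ≤ T) (st : List S) :
    Rule.value G.rules [.inl G.t] T (.inl u :: st.map .inr) = G.pathSum u st := by
  classical
  induction T generalizing u st with
  | zero =>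
    by_cases h : u = G.t
    · subst h
      simp [Rule.value, pathSum_t]
    · rw [pathSum_of_ne _ h, Finset.sum_eq_zero]
      · simp [Rule.value, h]
      · intro x _
        rw [if_neg]
        intro hx
        have := G.height_lt_of_adj hx
        omega
  | succ T ih =>
    by_cases h : u = G.t
    · subst h
      exact G.value_rules_t (T + 1) st
    · rw [Rule.value, Rule.step, rules, pathSum_of_ne _ h, if_neg h]
      have key : ∀ x, G.Adj u x →
          (run [(G.σ u x).map .inr, push (.inl x)] (st.map .inr)).elim 0
            (Rule.value G.rules [.inl G.t] T) = ((G.σ u x).apply st).elim 0 (G.pathSum x) := by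
        intro x hx
        have := G.height_lt_of_adj hx
        rw [run, apply_map Sum.inr_injective]
        cases (G.σ u x).apply st with
        | none => rfl
        | some st' => exact ih x (by omega) st'
      rw [← Finset.sum_map_toList]
      generalize (Finset.univ : Finset G.V).toList = l
      induction l with
      | nil => rfl
      | cons x l ihl =>
        rw [List.flatMap_cons, List.map_append, List.sum_append, List.map_cons, List.sum_cons, ihl]
        congr 1
        split_ifs with hx
        · simp [key x hx]
        · rfl

/-! ### Reduction of the symbol set -/

/-- A program over a finite symbol set is simulated in width two over two symbols. -/
theorem exists_width_two_of_fintype [Field F] [Fintype S] (G : SBP F S) :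
    ∃ G' : SBP F (Fin 2), G'.size ≤ rewritingSize (G.size + Fintype.card S) (G.size + 1) G.size ∧
      G'.HasWidth 2 ∧ G'.poly = G.poly := by
  obtain ⟨G', h₁, h₂, h₃⟩ := exists_sbp_poly_eq_value G.rules G.length_rules_le
    G.length_ops_le_of_mem_rules (ini := [.inl G.s]) (fin := [.inl G.t]) (by simp) (by simp) G.size
  refine ⟨G', ?_, h₂, ?_⟩
  · rwa [Fintype.card_sum] at h₁
  · rw [h₃, poly_eq_pathSum]
    exact G.value_rules G.size G.s (G.height_le_size _) []

/-- The same program with other stack operations. -/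
def withOps {S' : Type*} (G : SBP F S) (τ : G.V → G.V → StackOp S') : SBP F S' where
  toABP := G.toABP
  σ := τ

theorem ops_withOps {S' : Type*} (G : SBP F S) (g : S → S') (P : List G.V) :
    (G.withOps fun u x => (G.σ u x).map g).ops P = (G.ops P).map (StackOp.map g) := by
  induction P with
  | nil => rfl
  | cons u P ih =>
    cases P with
    | nil => rfl
    | cons x P => exact congrArg (List.cons _) ih

theorem poly_withOps [Field F] {S' : Type*} (G : SBP F S) {g : S → S'}
    (h : ∀ P, Realizable ((G.ops P).map (StackOp.map g)) → Realizable (G.ops P)) :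
    (G.withOps fun u x => (G.σ u x).map g).poly = G.poly := by
  refine Finset.sum_congr ?_ fun _ _ => rfl
  ext P
  refine (Set.Finite.mem_toFinset _).trans (Iff.trans ?_ (Set.Finite.mem_toFinset _).symm)
  refine and_congr Iff.rfl ?_
  have hP := congrArg Realizable (G.ops_withOps g P)
  exact ⟨fun h' => h P (hP.mp h'), fun h' => hP.mpr (h'.map g)⟩

/-- Only finitely many symbols occur in a program, so that they can be renamed to pairs of
vertices: a symbol is named by an edge that carries it. -/
theorem exists_poly_eq_over_edges [Field F] (G : SBP F S) :
    ∃ G' : SBP F (G.V × G.V), G'.size = G.size ∧ G'.poly = G.poly := by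
  classical
  rcases isEmpty_or_nonempty S with hS | hS
  · refine ⟨G.withOps fun u x => (G.σ u x).map isEmptyElim, rfl, G.poly_withOps fun P _ => ?_⟩
    induction G.ops P with
    | nil => exact .nil
    | cons o Q ih =>
      cases o with
      | push a => exact isEmptyElim a
      | pop a => exact isEmptyElim a
      | nop => exact .nop_left ih
  · have : Nonempty (G.V × G.V) := ⟨(G.s, G.t)⟩
    let symbol : G.V × G.V → S := fun e =>
      match G.σ e.1 e.2 with
      | push a => a
      | pop a => a
      | nop => Classical.arbitrary S
    let g : S → G.V × G.V := Function.invFun symbol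
    have hg : ∀ u x, ((G.σ u x).map g).map symbol = G.σ u x := by
      intro u x
      have h : symbol (g (symbol (u, x))) = symbol (u, x) := Function.invFun_eq ⟨_, rfl⟩
      cases hσ : G.σ u x with
      | push a =>
        have : symbol (u, x) = a := by simp [symbol, hσ]
        simpa [StackOp.map, this] using h
      | pop a =>
        have : symbol (u, x) = a := by simp [symbol, hσ]
        simpa [StackOp.map, this] using h
      | nop => rfl
    refine ⟨G.withOps fun u x => (G.σ u x).map g, rfl, G.poly_withOps fun P h => ?_⟩
    have h' := h.map symbol
    rw [← ops_withOps] at h'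
    have hops : ∀ P : List G.V, ((G.withOps fun u x => (G.σ u x).map g).ops P).map
        (StackOp.map symbol) = G.ops P := by
      intro P
      induction P with
      | nil => rfl
      | cons u P ih =>
        cases P with
        | nil => rfl
        | cons x P => exact congrArg₂ List.cons (hg u x) ih
    rwa [hops] at h'

/-- Every stack branching program is simulated in width two over two symbols. -/
theorem exists_width_two [Field F] (G : SBP F S) :
    ∃ G' : SBP F (Fin 2), G'.size ≤ rewritingSize (G.size + G.size * G.size) (G.size + 1) G.size ∧
      G'.HasWidth 2 ∧ G'.poly = G.poly := by
  obtain ⟨G₁, h₁, h₂⟩ := G.exists_poly_eq_over_edges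
  obtain ⟨G₂, h₃, h₄, h₅⟩ := G₁.exists_width_two_of_fintype
  rw [h₁, Fintype.card_prod] at h₃
  exact ⟨G₂, h₃, h₄, h₅.trans h₂⟩

end SBP

/-! ### Simulation of arithmetic circuits -/

theorem List.sum_map_range_eq {M : Type*} [AddCommMonoid M] (f : ℕ → M) (n : ℕ) :
    ((List.range n).map f).sum = ∑ i ∈ Finset.range n, f i := by
  induction n with
  | zero => rfl
  | succ n ih => simp [List.range_succ, Finset.sum_range_succ, ih]

open MvPolynomial in
theorem MvPolynomial.homogeneousComponent_mul {σ R : Type*} [CommSemiring R]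
    (f g : MvPolynomial σ R) (d : ℕ) : homogeneousComponent d (f * g) =
      ∑ i ∈ Finset.range (d + 1), homogeneousComponent i f * homogeneousComponent (d - i) g := by
  classical
  ext m
  rw [coeff_homogeneousComponent, coeff_sum]
  simp only [coeff_mul]
  rw [Finset.sum_comm]
  have h : ∀ x ∈ Finset.HasAntidiagonal.antidiagonal m, ∑ i ∈ Finset.range (d + 1),
      coeff x.1 (homogeneousComponent i f) * coeff x.2 (homogeneousComponent (d - i) g) =
      if m.degree = d then coeff x.1 f * coeff x.2 g else 0 := by
    rintro ⟨x, y⟩ hx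
    have hd : x.degree + y.degree = m.degree := by
      rw [← Finset.HasAntidiagonal.mem_antidiagonal.1 hx, map_add]
    simp only [coeff_homogeneousComponent]
    split_ifs with hm
    · rw [Finset.sum_eq_single x.degree]
      · rw [if_pos rfl, if_pos (by omega)]
      · intro i _ hi
        rw [if_neg (Ne.symm hi), zero_mul]
      · intro hi
        exact (hi (Finset.mem_range.2 (by omega))).elim
    · refine Finset.sum_eq_zero fun i hi => ?_
      rw [Finset.mem_range] at hi
      split_ifs <;> first | omega | simp
  rw [Finset.sum_congr rfl h]
  split_ifs <;> simp

namespace ArithCircuit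

open StackOp MvPolynomial

variable {F : Type*}

/-- The stack symbols of the rewriting that evaluates a circuit up to degree `D`: the bottom symbol
`none`, the start symbol `some none`, and a symbol for each homogeneous component of degree at most
`D` of each gate. -/
abbrev Sym (C : ArithCircuit F) (D : ℕ) := Option (Option (C.V × Fin (D + 1)))

/-- The symbol for the homogeneous component of degree `d` at the gate `v`. It is used for `d ≤ D`
only, since `Fin.ofNat` reduces `d` modulo `D + 1`. -/
abbrev Sym.comp {C : ArithCircuit F} (D : ℕ) (v : C.V) (d : ℕ) : C.Sym D :=
  some (some (v, Fin.ofNat (D + 1) d))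

/-- The rules for the component of degree `d` at the gate `v`. The component of degree `0` is a
constant; rewriting it at once keeps the number of steps polynomial. -/
noncomputable def compRules [Field F] (C : ArithCircuit F) (D : ℕ) (v : C.V) (d : ℕ) :
    List (Rule F (C.Sym D)) :=
  if d = 0 then [⟨.const (coeff 0 (C.valueAt v)), []⟩]
  else match C.gate v with
  | .input (.const _) => []
  | .input (.var i) => if d = 1 then [⟨.var i, []⟩] else []
  | .add u w => [⟨.const 1, [push (.comp D u d)]⟩, ⟨.const 1, [push (.comp D w d)]⟩]
  | .mul u w => (List.range (d + 1)).map fun i =>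
      ⟨.const 1, [push (.comp D w (d - i)), push (.comp D u i)]⟩

/-- The rules for all symbols: the start symbol becomes some component of the output gate, and the
bottom symbol may wait. -/
noncomputable def rules [Field F] (C : ArithCircuit F) (D : ℕ) : C.Sym D → List (Rule F (C.Sym D))
  | none => [⟨.const 1, [push none]⟩]
  | some none => (List.range (D + 1)).map fun d => ⟨.const 1, [push (.comp D C.output d)]⟩
  | some (some (v, d)) => C.compRules D v d

theorem length_rules_le [Field F] (C : ArithCircuit F) (D : ℕ) (A : C.Sym D) :
    (C.rules D A).length ≤ D + 2 := by
  match A with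
  | none => simp [rules]
  | some none => simp [rules]
  | some (some (v, d)) =>
    rw [rules, compRules]
    split
    · simp
    · split
      · simp
      · split <;> simp
      · simp
      · simp

theorem length_ops_le_of_mem_rules [Field F] (C : ArithCircuit F) (D : ℕ) (A : C.Sym D) :
    ∀ r ∈ C.rules D A, r.ops.length ≤ 2 := by
  intro r hr
  match A with
  | none =>
    obtain rfl := List.mem_singleton.1 hr
    simp
  | some none =>
    obtain ⟨d, -, rfl⟩ := List.mem_map.1 hr
    simp
  | some (some (v, d)) =>
    rw [rules, compRules] at hr
    split at hr
    · obtain rfl := List.mem_singleton.1 hr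
      simp
    · split at hr
      · simp at hr
      · split at hr <;> simp at hr
        simp [hr]
      · simp only [List.mem_cons, List.not_mem_nil, or_false] at hr
        rcases hr with rfl | rfl <;> simp
      · obtain ⟨i, -, rfl⟩ := List.mem_map.1 hr
        simp

/-- The number of gates below `v`, including `v`. -/
noncomputable def height (C : ArithCircuit F) (v : C.V) : ℕ :=
  {u | Relation.TransGen (fun u v => (C.gate v).HasChild u) u v}.ncard + 1

theorem height_lt_of_hasChild (C : ArithCircuit F) {u v : C.V} (h : (C.gate v).HasChild u) :
    C.height u < C.height v := by
  refine Nat.succ_lt_succ (Set.ncard_lt_ncard ⟨fun y hy => ?_, fun h' => ?_⟩ (Set.toFinite _))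
  · exact Relation.TransGen.tail hy h
  · exact C.acyclic u (h' (Relation.TransGen.single h))

theorem height_le (C : ArithCircuit F) (v : C.V) : C.height v ≤ C.size + 1 := by
  refine Nat.succ_le_succ ((Set.ncard_le_ncard (Set.subset_univ _)).trans_eq ?_)
  rw [Set.ncard_univ, Nat.card_eq_fintype_card, ArithCircuit.size]

/-- A bound on the number of steps that rewrite a symbol into the empty stack. -/
noncomputable def rank (C : ArithCircuit F) (D : ℕ) : C.Sym D → ℕ
  | none => 0
  | some none => 2 * (C.height C.output * D) + 2
  | some (some (v, d)) => 2 * (C.height v * d) + 1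

/-- The polynomial that a symbol stands for. The start symbol stands for the sum of the components
of the output gate. -/
noncomputable def symPoly [Field F] (C : ArithCircuit F) (D : ℕ) : C.Sym D → MvPolynomial ℕ F
  | none => 1
  | some none => ∑ d ∈ Finset.range (D + 1), homogeneousComponent d C.poly
  | some (some (v, d)) => homogeneousComponent d (C.valueAt v)

theorem rank_comp (C : ArithCircuit F) {D d : ℕ} (v : C.V) (hd : d ≤ D) :
    C.rank D (.comp D v d) = 2 * (C.height v * d) + 1 := by
  simp [rank, Nat.mod_eq_of_lt (Nat.lt_succ_of_le hd)]

theorem symPoly_comp [Field F] (C : ArithCircuit F) {D d : ℕ} (v : C.V) (hd : d ≤ D) :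
    C.symPoly D (.comp D v d) = homogeneousComponent d (C.valueAt v) := by
  simp [symPoly, Nat.mod_eq_of_lt (Nat.lt_succ_of_le hd)]

theorem value_rules_bottom [Field F] (C : ArithCircuit F) (D T : ℕ) :
    Rule.value (C.rules D) [none] T [none] = 1 := by
  induction T with
  | zero => simp [Rule.value]
  | succ T ih => simp [Rule.value, Rule.step, rules, run, apply, ih, Label.toPoly]

/-- If the number of steps suffices, a stack of symbols is rewritten with total weight the product
of the polynomials that its symbols stand for. -/
theorem value_rules [Field F] (C : ArithCircuit F) (D T : ℕ) (st : List (Option (C.V × Fin (D + 1))))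
    (h : (st.map fun A => C.rank D (some A)).sum ≤ T) :
    Rule.value (C.rules D) [none] T (st.map some ++ [none]) =
      (st.map fun A => C.symPoly D (some A)).prod := by
  induction T generalizing st with
  | zero =>
    match st with
    | [] => simp [Rule.value]
    | none :: st => simp [rank] at h
    | some (v, d) :: st => simp [rank] at h
  | succ T ih =>
    have ih₁ : ∀ (st : List (Option (C.V × Fin (D + 1)))) u e, e ≤ D →
        2 * (C.height u * e) + 1 + (st.map fun A => C.rank D (some A)).sum ≤ T →
        Rule.value (C.rules D) [none] T (.comp D u e :: (st.map some ++ [none])) =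
          homogeneousComponent e (C.valueAt u) * (st.map fun A => C.symPoly D (some A)).prod := by
      intro st u e he h
      rw [← C.rank_comp u he] at h
      rw [← C.symPoly_comp u he]
      exact ih (some (u, Fin.ofNat (D + 1) e) :: st) (by rwa [List.map_cons, List.sum_cons])
    match st with
    | [] => exact C.value_rules_bottom D (T + 1)
    | none :: st =>
      rw [List.map_cons, List.sum_cons, rank] at h
      rw [List.map_cons, List.cons_append, Rule.value, Rule.step, rules, List.map_map,
        List.map_cons, List.prod_cons, symPoly, Finset.sum_mul, List.sum_map_range_eq]
      refine Finset.sum_congr rfl fun d hd => ?_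
      have hd : d ≤ D := Nat.lt_succ_iff.1 (Finset.mem_range.1 hd)
      have := Nat.mul_le_mul_left (C.height C.output) hd
      simp only [Function.comp_apply, run, apply, Option.bind_some, Option.elim_some, Label.toPoly,
        C_1, one_mul]
      exact ih₁ st C.output d hd (by omega)
    | some (v, d) :: st =>
      obtain ⟨d, hd⟩ := d
      have hd : d ≤ D := Nat.lt_succ_iff.1 hd
      rw [List.map_cons, List.sum_cons, rank] at h
      rw [List.map_cons, List.cons_append, Rule.value, Rule.step, rules, compRules, List.map_cons,
        List.prod_cons, symPoly]
      replace h : 2 * (C.height v * d) + 1 + (st.map fun A => C.rank D (some A)).sum ≤ T + 1 := h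
      by_cases h0 : d = 0
      · subst h0
        have := ih st (by omega)
        simp [run, this, Label.toPoly, homogeneousComponent_zero]
      · simp only [if_neg h0]
        have hmul : ∀ u e, (C.gate v).HasChild u → C.height u * e + e ≤ C.height v * e := by
          intro u e hu
          rw [← Nat.succ_mul]
          exact Nat.mul_le_mul_right e (C.height_lt_of_hasChild hu)
        split
        next a hv =>
          rw [C.valueAt_input hv, Label.toPoly, homogeneousComponent_of_mem (isHomogeneous_C _ a),
            if_neg h0]
          simp
        next i hv =>
          rw [C.valueAt_input hv, Label.toPoly, homogeneousComponent_of_mem (isHomogeneous_X _ i)]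
          have := ih st (by omega)
          split_ifs <;> simp [run, this, Label.toPoly]
        next u w hv =>
          have h₁ := hmul u d (by rw [hv]; exact Or.inl rfl)
          have h₂ := hmul w d (by rw [hv]; exact Or.inr rfl)
          have h₁ := ih₁ st u d hd (by omega)
          have h₂ := ih₁ st w d hd (by omega)
          simp [C.valueAt_add hv, run, apply, Label.toPoly, add_mul, h₁, h₂]
        next u w hv =>
          rw [C.valueAt_mul hv, homogeneousComponent_mul, Finset.sum_mul, List.map_map,
            List.sum_map_range_eq]
          refine Finset.sum_congr rfl fun i hi => ?_
          have hi : i ≤ d := Nat.lt_succ_iff.1 (Finset.mem_range.1 hi)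
          simp only [Function.comp_apply, run, apply, Option.bind_some, Option.elim_some,
            Label.toPoly, C_1, one_mul]
          have h₁ := hmul u i (by rw [hv]; exact Or.inl rfl)
          have h₂ := hmul w (d - i) (by rw [hv]; exact Or.inr rfl)
          -- If one factor has degree `0`, its single step is paid for by the other one, since `0 < d`.
          have h₃ : C.height v * i + C.height v * (d - i) = C.height v * d := by
            rw [← Nat.mul_add, Nat.add_sub_cancel' hi]
          have h₄ := C.rank_comp w (hd := (Nat.sub_le d i).trans hd)
          have h₅ := C.symPoly_comp w (hd := (Nat.sub_le d i).trans hd)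
          have := ih₁ (some (w, Fin.ofNat (D + 1) (d - i)) :: st) u i (hi.trans hd)
            (by rw [List.map_cons, List.sum_cons, h₄]; omega)
          rw [List.map_cons (f := fun A => C.symPoly D (some A)), List.prod_cons, h₅,
            ← mul_assoc] at this
          exact this

/-- A circuit that computes a polynomial of degree at most `D` is simulated in width two over two
symbols. -/
theorem exists_width_two [Field F] (C : ArithCircuit F) {D : ℕ} (hD : C.poly.totalDegree ≤ D) :
    ∃ G : SBP F (Fin 2),
      G.size ≤ rewritingSize (C.size * (D + 1) + 2) (D + 2) (2 * ((C.size + 1) * D) + 2) ∧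
      G.HasWidth 2 ∧ G.poly = C.poly := by
  obtain ⟨G, h₁, h₂, h₃⟩ := exists_sbp_poly_eq_value (C.rules D) (C.length_rules_le D)
    (C.length_ops_le_of_mem_rules D) (ini := [some none, none]) (fin := [none]) (by simp) (by simp)
    (2 * ((C.size + 1) * D) + 2)
  refine ⟨G, ?_, h₂, ?_⟩
  · rwa [Fintype.card_option, Fintype.card_option, Fintype.card_prod, Fintype.card_fin] at h₁
  · rw [h₃]
    have := Nat.mul_le_mul_right D (C.height_le C.output)
    refine (C.value_rules D _ [none] (by simpa [rank] using this)).trans ?_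
    rw [List.map_singleton, List.prod_singleton, symPoly]
    conv_rhs => rw [← sum_homogeneousComponent C.poly]
    refine (Finset.sum_subset (Finset.range_mono (by omega)) fun d _ hd => ?_).symm
    exact homogeneousComponent_eq_zero _ _ (by simpa using hd)

end ArithCircuit

/-! ### Families of polynomial size -/

/-- The size of the simulating programs is polynomially bounded. -/
theorem exists_polynomial_eval_eq_rewritingSize (g M T : Polynomial ℕ) :
    ∃ q : Polynomial ℕ, ∀ n, q.eval n = rewritingSize (g.eval n) (M.eval n) (T.eval n) :=
  ⟨2 * (2 + 4 * (g + 1) + T * (g * M * (4 * (g + 1) + 3) + (g + 1))), fun n => by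
    simp [rewritingSize]⟩

theorem mainTheorem3 (F : Type*) [Field F] :
    (∀ f ∈ VP F, ComputedByPolySizeSBPsOfWidth 2 (Fin 2) f) ∧
      (∀ (S : ℕ → Type*) (f : ℕ → MvPolynomial ℕ F),
        ComputedByPolySizeSBPs S f → ComputedByPolySizeSBPsOfWidth 2 (Fin 2) f) := by
  constructor
  · rintro f ⟨⟨D, hD⟩, p, C, hC⟩
    have h n := (C n).exists_width_two (D := D.eval n) (by rw [(hC n).2]; exact hD n)
    choose G hsize hwidth hpoly using h
    obtain ⟨q, hq⟩ := exists_polynomial_eval_eq_rewritingSize (p * (D + 1) + 2) (D + 2)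
      (2 * ((p + 1) * D) + 2)
    refine ⟨q, G, fun n => ⟨(hsize n).trans ?_, hwidth n, (hpoly n).trans (hC n).2⟩⟩
    have := (hC n).1
    rw [hq]
    simp only [Polynomial.eval_add, Polynomial.eval_mul, Polynomial.eval_one,
      Polynomial.eval_ofNat]
    refine rewritingSize_mono ?_ le_rfl ?_ <;> gcongr
  · rintro S f ⟨p, H, hH⟩
    choose G hsize hwidth hpoly using fun n => (H n).exists_width_two
    obtain ⟨q, hq⟩ := exists_polynomial_eval_eq_rewritingSize (p + p * p) (p + 1) p
    refine ⟨q, G, fun n => ⟨(hsize n).trans ?_, hwidth n, (hpoly n).trans (hH n).2⟩⟩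
    have := (hH n).1
    rw [hq]
    simp only [Polynomial.eval_add, Polynomial.eval_mul, Polynomial.eval_one]
    refine rewritingSize_mono ?_ ?_ this <;> gcongr
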